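/- Let $k\ge 1$ be an integer. For complex $q$ with $0<|q|<1$ and complex $a$ write $(a;q)_n=\prod_{0\le j<n}(1-aq^j)$ for $n\in\mathbb{N}_0\cup\{\infty\}$, $(a_1,\dots,a_m;q)_n=\prod_{i=1}^m(a_i;q)_n$, and $\begin{bmatrix}N\\r\end{bmatrix}_q=\frac{(q;q)_N}{(q;q)_r(q;q)_{N-r}}$ for integers $0\le r\le N$. (i) If $z\in\mathbb{C}\setminus\{0\}$ and $z\ne q^m$ for all $m\in\mathbb{Z}$, then both series on the right converge absolutely and $$\frac{(-1)^{k-1}}{(z,q/z,q;q)_\infty}\sum_{0\le n<k}(-1)^nq^{n(n+1)/2}z^{-n}(1-z^{2n+1})-(-1)^{k-1}$$ $$=\sum_{n\ge k}\frac{z^{-k}(1+z)q^{n+\binom k2}}{(q/z,qz;q)_n}\begin{bmatrix}2n-1\\n-k\end{bmatrix}_q+\frac{1-z^{2k-1}}{1-z}\sum_{n\ge k}\frac{z^{2-k}q^{n+\binom k2}}{(q;q)_{n-k}(qz;q)_n(q/z;q)_\infty}.$$ (ii) If $z\in\mathbb{C}\setminus\{0\}$ and $z\ne q^m$ for all $m\in\mathbb{Z}\setminus\{0\}$,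 then both series on the right converge absolutely and $$\frac{(-1)^{k-1}}{(qz,q/z,q;q)_\infty}\sum_{-k<n<k}(-1)^nq^{n(n-1)/2}z^n-(-1)^{k-1}(1-z)$$ $$=\sum_{n\ge k}\frac{z^{-k}q^{n+\binom k2}}{(q;q)_{n-k}(q/z;q)_n(qz;q)_\infty}+\sum_{n\ge k}\frac{z^kq^{n-k+\binom k2}}{(q;q)_{n-k}(qz;q)_{n-1}(q/z;q)_\infty}.$$ (iii) Each of the two summands on the right-hand side of (i) (the second one including its factor $\frac{1-z^{2k-1}}{1-z}$) and each of the two summands on the right-hand side of (ii) has an expansion $\sum_{n\ge0}\sum_{m\in\mathbb{Z}}c(n,m)q^nz^m$ with real coefficients $c(n,m)\ge 0$ that do not depend on $q$ and $z$, absolutely convergent for $0<|q|<1$, $|q|<|z|<1/|q|$, $z\neq 1$. -/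

import Mathlib

/-- The infinite `q`-shifted factorial `(a;q)_∞ = ∏_{j ≥ 0} (1 - a q^j)`, used for `|q| < 1`. -/
noncomputable def qPochInf (a q : ℂ) : ℂ := ∏' j : ℕ, (1 - a * q ^ j)

/-- The finite `q`-shifted factorial `(a;q)_n = ∏_{0 ≤ j < n} (1 - a q^j)`, for `n ∈ ℕ`. -/
noncomputable def qPoch (a q : ℂ) (n : ℕ) : ℂ := ∏ j ∈ Finset.range n, (1 - a * q ^ j)

/-- The product defining `(a;q)_∞` converges for every `a` when `|q| < 1`. -/
theorem multipliable_qPochInf (a : ℂ) {q : ℂ} (hq : ‖q‖ < 1) :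
    Multipliable fun j : ℕ => 1 - a * q ^ j := by
  have h : Summable fun j : ℕ => ‖-(a * q ^ j)‖ := by
    simpa [norm_mul, norm_pow] using
      (summable_geometric_of_lt_one (norm_nonneg q) hq).mul_left ‖a‖
  simpa [sub_eq_add_neg] using multipliable_one_add_of_summable h

/-- `(a;q)_n = (a;q)_∞ / (a q^n;q)_∞` whenever the denominator does not vanish. -/
theorem qPoch_eq_div (a : ℂ) {q : ℂ} (hq : ‖q‖ < 1) (n : ℕ)
    (h : qPochInf (a * q ^ n) q ≠ 0) :
    qPoch a q n = qPochInf a q / qPochInf (a * q ^ n) q := by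
  have e : (fun j : ℕ => 1 - a * q ^ (j + n)) = fun j : ℕ => 1 - a * q ^ n * q ^ j := by
    funext j; ring
  have h2 := Multipliable.prod_mul_tprod_nat_mul' (f := fun j : ℕ => 1 - a * q ^ j) (k := n)
    (by simpa only [e] using multipliable_qPochInf (a * q ^ n) hq)
  rw [eq_div_iff h]
  simpa only [e, qPoch, qPochInf] using h2

/-- The `q`-binomial coefficient `(q;q)_n / ((q;q)_k (q;q)_{n-k})` for `0 ≤ k ≤ n`
(and `0` for `k > n`). -/
noncomputable def qBinom (n k : ℕ) (q : ℂ) : ℂ :=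
  if k ≤ n then qPoch q q n / (qPoch q q k * qPoch q q (n - k)) else 0

/-- The function `F(q,z)` has a convergent expansion `∑_{n ≥ 0, m ∈ ℤ} c(n,m) q^n z^m` with all
coefficients real and non-negative, absolutely convergent to `F(q,z)` whenever `0 < |q| < 1`,
`|q| < |z| < 1/|q|` and `z ≠ 1`. (At `z = 1` some of the functions considered are written with a
factor `1 - z` in a denominator; the coefficients are determined by the values for `z ≠ 1`.) -/
def HasNonnegExpansion (F : ℂ → ℂ → ℂ) : Prop :=
  ∃ c : ℕ → ℤ → ℝ, (∀ n m, 0 ≤ c n m) ∧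
    ∀ q z : ℂ, 0 < ‖q‖ → ‖q‖ < 1 → ‖q‖ < ‖z‖ → ‖z‖ < 1 / ‖q‖ → z ≠ 1 →
      HasSum (fun p : ℕ × ℤ => (c p.1 p.2 : ℂ) * q ^ p.1 * z ^ p.2) (F q z)

/-- `z^{-k} (1+z) q^{n + C(k,2)} / (q/z, qz; q)_n` times the `q`-binomial of `2n-1` over `n-k`. -/
noncomputable def termI₁ (k : ℕ) (q z : ℂ) (n : ℕ) : ℂ :=
  z ^ (-(k : ℤ)) * (1 + z) * q ^ (n + k.choose 2) / (qPoch (q / z) q n * qPoch (q * z) q n) *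
    qBinom (2 * n - 1) (n - k) q

/-- `z^{2-k} q^{n + C(k,2)} / ((q;q)_{n-k} (qz;q)_n (q/z;q)_∞)`. -/
noncomputable def termI₂ (k : ℕ) (q z : ℂ) (n : ℕ) : ℂ :=
  z ^ (2 - (k : ℤ)) * q ^ (n + k.choose 2) /
    (qPoch q q (n - k) * qPoch (q * z) q n * qPochInf (q / z) q)

/-- `z^{-k} q^{n + C(k,2)} / ((q;q)_{n-k} (q/z;q)_n (qz;q)_∞)`. -/
noncomputable def termII₁ (k : ℕ) (q z : ℂ) (n : ℕ) : ℂ :=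
  z ^ (-(k : ℤ)) * q ^ (n + k.choose 2) /
    (qPoch q q (n - k) * qPoch (q / z) q n * qPochInf (q * z) q)

/-- `z^k q^{n - k + C(k,2)} / ((q;q)_{n-k} (qz;q)_{n-1} (q/z;q)_∞)`. -/
noncomputable def termII₂ (k : ℕ) (q z : ℂ) (n : ℕ) : ℂ :=
  z ^ k * q ^ (n - k + k.choose 2) /
    (qPoch q q (n - k) * qPoch (q * z) q (n - 1) * qPochInf (q / z) q)

/-!
Write `θ(a) = ∑_{j ≥ 0} (-1)^j q^{j(j-1)/2} a^j` for the partial theta function and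
`T(a, b) = ∑_{j ≥ 0} (-1)^j q^{j(j-1)/2} h_j(a, b)` for its two-variable analogue, with `h_j` the
complete homogeneous symmetric polynomial, so that `T(a, 0) = θ(a)` and
`(a - b) T(a, b) = a θ(a) - b θ(b)`. Everything rests on the summation (`hasSum_qPoch_div`)

  `∑_{m ≥ 0} q^m (a b q^{m-2};q)_m / (q, a, b;q)_m = T(a, b) / (a, b, q;q)_∞`.

After multiplication by `(a, b, q;q)_∞`, both sides make sense for all `a`, `b`, are bounded on
bounded sets, and satisfy `F(a, b) = 1 - (a + b) F(a q, b q) - a b q F(a q^2, b q^2)`: for `T` this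
is the recurrence of `h_j` (`partialTheta_eq`), for the series it is a telescoping sum
(`sum_warnaarTerm`). The difference of the two sides therefore solves a homogeneous backward
recursion along `(a q^n, b q^n)` whose coefficients tend to `0`, hence vanishes
(`tsum_warnaarTerm`). For `a b = q` the same summation yields Jacobi's triple product
`(a, b, q;q)_∞ = θ(a) + θ(b) - 1`, because the terms of the series at `(a q^2, b q^2)` are, up to
the factor `q^2`, those at `(a, b)` shifted by two.

With `a = q^{k+1} z` and `b = q^{k+1} / z`, or with `b = 0` and `a` one of `q^{k+1} z`,
`q^{k+1} / z`, `q^k z`, the summation evaluates each of the four series as a multiple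
of a value of `T` or `θ` over `(qz, q/z, q;q)_∞`. These values are the tails left
when the theta series of the triple product is truncated, and the two identities follow by
splitting `θ(z)` and `θ(q/z)` after `k` terms.

For the non-negativity, every factor of every term is a sum of monomials `q^n z^m`, i.e. a series
with natural number coefficients (`IsMonomialSeries`): the `q`-binomial coefficient by Pascal's
rule, the reciprocals of finite products by geometric series, and those of infinite products by
`1 / (x;q)_∞ = 1 + ∑_l x q^l / (x;q)_{l+1}`. Products and convergent sums of such functions are
again of this kind, absolute convergence of the sum over `n` at `(q, z)` being its convergence at
the real point `(|q|, |z|)`, where all terms are non-negative.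
-/

/-! ### Shifted factorials -/

theorem qPoch_zero (a q : ℂ) : qPoch a q 0 = 1 := by simp [qPoch]

theorem qPoch_succ (a q : ℂ) (n : ℕ) : qPoch a q (n + 1) = qPoch a q n * (1 - a * q ^ n) := by
  simp [qPoch, Finset.prod_range_succ]

theorem qPoch_add (a q : ℂ) (m n : ℕ) :
    qPoch a q (m + n) = qPoch a q m * qPoch (a * q ^ m) q n := by
  simp only [qPoch, Finset.prod_range_add, pow_add, mul_assoc]

theorem qPoch_succ_left (a q : ℂ) (n : ℕ) :
    qPoch a q (n + 1) = (1 - a) * qPoch (a * q) q n := by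
  rw [add_comm, qPoch_add]
  simp [qPoch]

theorem qPoch_zero_left (q : ℂ) (n : ℕ) : qPoch 0 q n = 1 := by simp [qPoch]

theorem qPochInf_zero_left (q : ℂ) : qPochInf 0 q = 1 := by simp [qPochInf]

theorem tendsto_qPoch (a : ℂ) {q : ℂ} (hq : ‖q‖ < 1) :
    Filter.Tendsto (qPoch a q) Filter.atTop (nhds (qPochInf a q)) :=
  (multipliable_qPochInf a hq).hasProd.tendsto_prod_nat

theorem qPochInf_eq_mul (a : ℂ) {q : ℂ} (hq : ‖q‖ < 1) (n : ℕ) :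
    qPochInf a q = qPoch a q n * qPochInf (a * q ^ n) q := by
  refine tendsto_nhds_unique ((Filter.tendsto_add_atTop_iff_nat n).2 (tendsto_qPoch a hq)) ?_
  have h := (tendsto_qPoch (a * q ^ n) hq).const_mul (qPoch a q n)
  refine h.congr fun m => ?_
  rw [add_comm m n, qPoch_add]

theorem qPochInf_eq_one_sub_mul (a : ℂ) {q : ℂ} (hq : ‖q‖ < 1) :
    qPochInf a q = (1 - a) * qPochInf (a * q) q := by
  have h := qPochInf_eq_mul a hq 1
  simpa [qPoch] using h

theorem norm_qPoch_sub_one_le (a : ℂ) {q : ℂ} (hq : ‖q‖ < 1) (n : ℕ) :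
    ‖qPoch a q n - 1‖ ≤ Real.exp (‖a‖ / (1 - ‖q‖)) - 1 := by
  have h := Finset.norm_prod_one_add_sub_one_le (Finset.range n) fun j => -(a * q ^ j)
  simp only [← sub_eq_add_neg, norm_neg, norm_mul, norm_pow] at h
  refine h.trans (sub_le_sub_right (Real.exp_le_exp.2 ?_) 1)
  rw [← Finset.mul_sum, div_eq_mul_inv]
  refine mul_le_mul_of_nonneg_left ?_ (norm_nonneg a)
  rw [← tsum_geometric_of_lt_one (norm_nonneg q) hq]
  exact (summable_geometric_of_lt_one (norm_nonneg q) hq).sum_le_tsum _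
    fun i _ => pow_nonneg (norm_nonneg q) i

theorem norm_qPochInf_sub_one_le (a : ℂ) {q : ℂ} (hq : ‖q‖ < 1) :
    ‖qPochInf a q - 1‖ ≤ Real.exp (‖a‖ / (1 - ‖q‖)) - 1 :=
  le_of_tendsto ((tendsto_qPoch a hq).sub_const 1).norm
    (Filter.Eventually.of_forall fun n => norm_qPoch_sub_one_le a hq n)

theorem norm_le_exp_of_norm_sub_one_le {x : ℂ} {e c : ℝ} (h : ‖x - 1‖ ≤ Real.exp e - 1)
    (hec : e ≤ c) : ‖x‖ ≤ Real.exp c := by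
  have h1 : ‖x‖ ≤ ‖x - 1‖ + ‖(1 : ℂ)‖ := by simpa using norm_add_le (x - 1) 1
  rw [norm_one] at h1
  linarith [Real.exp_le_exp.2 hec]

theorem norm_qPoch_le {a q : ℂ} {R : ℝ} (hq : ‖q‖ < 1) (ha : ‖a‖ ≤ R) (n : ℕ) :
    ‖qPoch a q n‖ ≤ Real.exp (R / (1 - ‖q‖)) :=
  norm_le_exp_of_norm_sub_one_le (norm_qPoch_sub_one_le a hq n)
    (div_le_div_of_nonneg_right ha (sub_nonneg.2 hq.le))

theorem norm_qPochInf_le {a q : ℂ} {R : ℝ} (hq : ‖q‖ < 1) (ha : ‖a‖ ≤ R) :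
    ‖qPochInf a q‖ ≤ Real.exp (R / (1 - ‖q‖)) :=
  norm_le_exp_of_norm_sub_one_le (norm_qPochInf_sub_one_le a hq)
    (div_le_div_of_nonneg_right ha (sub_nonneg.2 hq.le))

theorem tendsto_one_of_norm_sub_one_le {q : ℂ} {f a : ℕ → ℂ}
    (h : ∀ n, ‖f n - 1‖ ≤ Real.exp (‖a n‖ / (1 - ‖q‖)) - 1)
    (ha : Filter.Tendsto a Filter.atTop (nhds 0)) :
    Filter.Tendsto f Filter.atTop (nhds 1) := by
  rw [tendsto_iff_norm_sub_tendsto_zero]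
  refine squeeze_zero (fun n => norm_nonneg _) h ?_
  have h1 : Filter.Tendsto (fun n => ‖a n‖ / (1 - ‖q‖)) Filter.atTop (nhds 0) := by
    simpa using ha.norm.div_const (1 - ‖q‖)
  simpa using ((Real.continuous_exp.tendsto 0).comp h1).sub_const 1

theorem tendsto_mul_pow_zero (a : ℂ) {q : ℂ} (hq : ‖q‖ < 1) :
    Filter.Tendsto (fun n : ℕ => a * q ^ n) Filter.atTop (nhds 0) := by
  simpa using (tendsto_pow_atTop_nhds_zero_of_norm_lt_one hq).const_mul a

theorem tendsto_qPoch_mul_pow (a : ℂ) {q : ℂ} (hq : ‖q‖ < 1) :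
    Filter.Tendsto (fun n : ℕ => qPoch (a * q ^ n) q n) Filter.atTop (nhds 1) :=
  tendsto_one_of_norm_sub_one_le (fun n => norm_qPoch_sub_one_le _ hq n)
    (tendsto_mul_pow_zero a hq)

theorem tendsto_qPochInf_mul_pow (a : ℂ) {q : ℂ} (hq : ‖q‖ < 1) :
    Filter.Tendsto (fun n : ℕ => qPochInf (a * q ^ n) q) Filter.atTop (nhds 1) :=
  tendsto_one_of_norm_sub_one_le (fun _ => norm_qPochInf_sub_one_le _ hq)
    (tendsto_mul_pow_zero a hq)

theorem qPoch_ne_zero {a q : ℂ} (h : ∀ j : ℕ, a * q ^ j ≠ 1) (n : ℕ) : qPoch a q n ≠ 0 :=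
  Finset.prod_ne_zero_iff.2 fun j _ => sub_ne_zero.2 (h j).symm

theorem qPochInf_ne_zero {a q : ℂ} (hq : ‖q‖ < 1) (h : ∀ j : ℕ, a * q ^ j ≠ 1) :
    qPochInf a q ≠ 0 := by
  have hs : Summable fun j : ℕ => ‖-(a * q ^ j)‖ := by
    simpa [norm_mul, norm_pow] using
      (summable_geometric_of_lt_one (norm_nonneg q) hq).mul_left ‖a‖
  have := tprod_one_add_ne_zero_of_summable (f := fun j : ℕ => -(a * q ^ j))
    (fun j => by simpa [← sub_eq_add_neg, sub_eq_zero] using (h j).symm) hs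
  simpa [qPochInf, sub_eq_add_neg] using this

theorem mul_pow_ne_one_of_norm_lt_one {a q : ℂ} (ha : ‖a‖ < 1) (hq : ‖q‖ < 1) (j : ℕ) :
    a * q ^ j ≠ 1 := by
  intro h
  have h1 : ‖a‖ * ‖q‖ ^ j = 1 := by simpa using congrArg norm h
  have h2 : ‖a‖ * ‖q‖ ^ j ≤ ‖a‖ :=
    mul_le_of_le_one_right (norm_nonneg a) (pow_le_one₀ (norm_nonneg q) hq.le)
  linarith

/-! ### Partial theta functions in one and two variables -/

/-- The complete homogeneous symmetric polynomial `∑_{i + l = j} a^i b^l` in two variables. -/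
noncomputable def completeHom (a b : ℂ) (j : ℕ) : ℂ :=
  ∑ p ∈ Finset.HasAntidiagonal.antidiagonal j, a ^ p.1 * b ^ p.2

theorem completeHom_zero (a b : ℂ) : completeHom a b 0 = 1 := by simp [completeHom]

theorem completeHom_succ (a b : ℂ) (j : ℕ) :
    completeHom a b (j + 1) = b ^ (j + 1) + a * completeHom a b j := by
  simp [completeHom, Finset.Nat.sum_antidiagonal_succ, Finset.mul_sum, pow_succ', mul_assoc]

theorem completeHom_succ' (a b : ℂ) (j : ℕ) :
    completeHom a b (j + 1) = a ^ (j + 1) + b * completeHom a b j := by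
  simp [completeHom, Finset.Nat.sum_antidiagonal_succ', Finset.mul_sum, pow_succ',
    mul_left_comm]

theorem completeHom_one (a b : ℂ) : completeHom a b 1 = a + b := by
  rw [completeHom_succ, completeHom_zero]; ring

theorem completeHom_add_two (a b : ℂ) (j : ℕ) :
    completeHom a b (j + 2) = (a + b) * completeHom a b (j + 1) - a * b * completeHom a b j := by
  rw [completeHom_succ a b (j + 1)]
  linear_combination (-b) * completeHom_succ a b j

theorem completeHom_mul (a b x : ℂ) (j : ℕ) :
    completeHom (a * x) (b * x) j = x ^ j * completeHom a b j := by
  simp only [completeHom, Finset.mul_sum]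
  refine Finset.sum_congr rfl fun p hp => ?_
  rw [← Finset.HasAntidiagonal.mem_antidiagonal.1 hp]
  ring

theorem completeHom_zero_right (a : ℂ) (j : ℕ) : completeHom a 0 j = a ^ j := by
  cases j with
  | zero => simp [completeHom_zero]
  | succ j => rw [completeHom_succ']; simp

theorem sub_mul_completeHom (a b : ℂ) (j : ℕ) :
    (a - b) * completeHom a b j = a ^ (j + 1) - b ^ (j + 1) := by
  linear_combination completeHom_succ' a b j - completeHom_succ a b j

theorem completeHom_add_two_sub (a b : ℂ) (j : ℕ) :
    completeHom a b (j + 2) - a * b * completeHom a b j = a ^ (j + 2) + b ^ (j + 2) := by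
  linear_combination completeHom_succ a b (j + 1) + a * completeHom_succ' a b j

theorem norm_completeHom_le {a b : ℂ} {R : ℝ} (ha : ‖a‖ ≤ R) (hb : ‖b‖ ≤ R) (j : ℕ) :
    ‖completeHom a b j‖ ≤ (2 * R) ^ j := by
  have hR : 0 ≤ R := (norm_nonneg a).trans ha
  induction j with
  | zero => simp [completeHom_zero]
  | succ j ih =>
    rw [completeHom_succ]
    calc ‖b ^ (j + 1) + a * completeHom a b j‖ ≤ ‖b‖ ^ (j + 1) + ‖a‖ * ‖completeHom a b j‖ := by
          simpa using norm_add_le (b ^ (j + 1)) (a * completeHom a b j)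
      _ ≤ R ^ (j + 1) + R * (2 * R) ^ j := by gcongr
      _ ≤ R * (2 * R) ^ j + R * (2 * R) ^ j := by
          rw [pow_succ']
          gcongr
          linarith
      _ = (2 * R) ^ (j + 1) := by ring

theorem choose_succ_two (j : ℕ) : (j + 1).choose 2 = j.choose 2 + j := by
  rw [Nat.choose_succ_succ' j 1, Nat.choose_one_right, add_comm]

theorem summable_pow_choose_mul_pow {r : ℝ} (hr0 : 0 ≤ r) (hr1 : r < 1) {x : ℝ} (hx : 0 ≤ x) :
    Summable fun j : ℕ => r ^ j.choose 2 * x ^ j := by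
  have h : Filter.Tendsto (fun n : ℕ => r ^ n * x) Filter.atTop (nhds 0) := by
    simpa using (tendsto_pow_atTop_nhds_zero_of_lt_one hr0 hr1).mul_const x
  refine summable_of_ratio_norm_eventually_le (r := 1 / 2) (by norm_num) ?_
  filter_upwards [h.eventually_le_const (show (0 : ℝ) < 1 / 2 by norm_num)] with n hn
  rw [Real.norm_of_nonneg (by positivity), Real.norm_of_nonneg (by positivity),
    choose_succ_two]
  calc r ^ (n.choose 2 + n) * x ^ (n + 1) = r ^ n * x * (r ^ n.choose 2 * x ^ n) := by ring
    _ ≤ 1 / 2 * (r ^ n.choose 2 * x ^ n) := by gcongr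

/-- The general term `(-1)^j q^{j(j-1)/2} h_j(a, b)` of the two-variable partial theta function. -/
noncomputable def thetaTerm (q a b : ℂ) (j : ℕ) : ℂ :=
  (-1) ^ j * q ^ j.choose 2 * completeHom a b j

/-- The two-variable partial theta function `∑_{j ≥ 0} (-1)^j q^{j(j-1)/2} h_j(a, b)`, where `h_j`
is the complete homogeneous symmetric polynomial; at `b = 0` it is the usual partial theta
function `∑_{j ≥ 0} (-1)^j q^{j(j-1)/2} a^j`. -/
noncomputable def partialTheta (q a b : ℂ) : ℂ := ∑' j : ℕ, thetaTerm q a b j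

theorem norm_thetaTerm_le {q a b : ℂ} {R : ℝ} (ha : ‖a‖ ≤ R) (hb : ‖b‖ ≤ R) (j : ℕ) :
    ‖thetaTerm q a b j‖ ≤ ‖q‖ ^ j.choose 2 * (2 * R) ^ j := by
  simp only [thetaTerm, norm_mul, norm_pow, norm_neg, norm_one, one_pow, one_mul]
  exact mul_le_mul_of_nonneg_left (norm_completeHom_le ha hb j) (by positivity)

theorem summable_thetaTerm {q : ℂ} (hq : ‖q‖ < 1) (a b : ℂ) : Summable (thetaTerm q a b) :=
  .of_norm_bounded
    (summable_pow_choose_mul_pow (norm_nonneg q) hq (x := 2 * max ‖a‖ ‖b‖) (by positivity))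
    (norm_thetaTerm_le (le_max_left _ _) (le_max_right _ _))

theorem norm_partialTheta_le {q a b : ℂ} {R : ℝ} (hq : ‖q‖ < 1) (ha : ‖a‖ ≤ R) (hb : ‖b‖ ≤ R) :
    ‖partialTheta q a b‖ ≤ ∑' j : ℕ, ‖q‖ ^ j.choose 2 * (2 * R) ^ j :=
  tsum_of_norm_bounded (summable_pow_choose_mul_pow (norm_nonneg q) hq
    (by linarith [norm_nonneg a])).hasSum (norm_thetaTerm_le ha hb)

/-- The recurrence comes from `h_{j+2} = (a + b) h_{j+1} - a b h_j`. -/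
theorem partialTheta_eq {q : ℂ} (hq : ‖q‖ < 1) (a b : ℂ) :
    partialTheta q a b = 1 - (a + b) * partialTheta q (a * q) (b * q) -
      a * b * q * partialTheta q (a * q ^ 2) (b * q ^ 2) := by
  have h0 := summable_thetaTerm hq a b
  have h1 := summable_thetaTerm hq (a * q) (b * q)
  have e : ∀ j, thetaTerm q a b (j + 1 + 1) = -(a + b) * thetaTerm q (a * q) (b * q) (j + 1) -
      a * b * q * thetaTerm q (a * q ^ 2) (b * q ^ 2) j := by
    intro j
    simp only [thetaTerm, completeHom_mul, completeHom_add_two, choose_succ_two]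
    ring
  have h2 := (summable_thetaTerm hq (a * q ^ 2) (b * q ^ 2)).mul_left (a * b * q)
  rw [partialTheta, h0.tsum_eq_zero_add, ((summable_nat_add_iff 1).2 h0).tsum_eq_zero_add]
  simp only [e]
  rw [(((summable_nat_add_iff 1).2 h1).mul_left _).tsum_sub h2, tsum_mul_left, tsum_mul_left,
    partialTheta, partialTheta, h1.tsum_eq_zero_add]
  simp [thetaTerm, completeHom_zero, completeHom_one]
  ring

theorem partialTheta_zero_right_eq {q : ℂ} (hq : ‖q‖ < 1) (a : ℂ) :
    partialTheta q a 0 = 1 - a * partialTheta q (a * q) 0 := by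
  simpa using partialTheta_eq hq a 0

/-- Splitting off the first `k` terms of a partial theta function. -/
theorem partialTheta_zero_right_eq_sum_add {q : ℂ} (hq : ‖q‖ < 1) (a : ℂ) (k : ℕ) :
    partialTheta q a 0 = ∑ j ∈ Finset.range k, (-1) ^ j * q ^ j.choose 2 * a ^ j +
      (-1) ^ k * q ^ k.choose 2 * a ^ k * partialTheta q (a * q ^ k) 0 := by
  induction k with
  | zero => simp
  | succ k ih =>
    have h := partialTheta_zero_right_eq hq (a * q ^ k)
    rw [mul_assoc a (q ^ k) q, ← pow_succ] at h
    rw [Finset.sum_range_succ, choose_succ_two]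
    linear_combination ih + (-1) ^ k * q ^ k.choose 2 * a ^ k * h

theorem sub_mul_partialTheta {q : ℂ} (hq : ‖q‖ < 1) (a b : ℂ) :
    (a - b) * partialTheta q a b = a * partialTheta q a 0 - b * partialTheta q b 0 := by
  simp only [partialTheta, ← tsum_mul_left]
  rw [← ((summable_thetaTerm hq a 0).mul_left a).tsum_sub ((summable_thetaTerm hq b 0).mul_left b)]
  refine tsum_congr fun j => ?_
  simp only [thetaTerm, completeHom_zero_right]
  linear_combination (-1) ^ j * q ^ j.choose 2 * sub_mul_completeHom a b j

theorem partialTheta_sub {q : ℂ} (hq : ‖q‖ < 1) (a b : ℂ) :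
    partialTheta q a b - a * b * q * partialTheta q (a * q ^ 2) (b * q ^ 2) =
      partialTheta q a 0 + partialTheta q b 0 - 1 := by
  have h0 := summable_thetaTerm hq a b
  have ha := summable_thetaTerm hq a 0
  have hb := summable_thetaTerm hq b 0
  have h2 := (summable_thetaTerm hq (a * q ^ 2) (b * q ^ 2)).mul_left (a * b * q)
  have e : ∀ j, thetaTerm q a b (j + 1 + 1) =
      a * b * q * thetaTerm q (a * q ^ 2) (b * q ^ 2) j +
        (thetaTerm q a 0 (j + 1 + 1) + thetaTerm q b 0 (j + 1 + 1)) := by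
    intro j
    simp only [thetaTerm, completeHom_mul, completeHom_zero_right, choose_succ_two]
    linear_combination
      (-1) ^ (j + 1 + 1) * q ^ (j.choose 2 + j + (j + 1)) * completeHom_add_two_sub a b j
  have s {f : ℕ → ℂ} (hf : Summable f) : Summable fun j => f (j + 1 + 1) :=
    (summable_nat_add_iff 2).2 hf
  have t {f : ℕ → ℂ} (hf : Summable f) : ∑' j, f j = f 0 + (f 1 + ∑' j, f (j + 1 + 1)) := by
    rw [hf.tsum_eq_zero_add, ((summable_nat_add_iff 1).2 hf).tsum_eq_zero_add]
  rw [partialTheta, t h0]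
  simp only [e]
  rw [h2.tsum_add ((s ha).add (s hb)), (s ha).tsum_add (s hb), tsum_mul_left]
  simp only [partialTheta, t ha, t hb]
  simp [thetaTerm, completeHom_zero, completeHom_one]
  ring

/-! ### The product side of the two-variable summation -/

/-- The general term `q^m (a b q^{m-2};q)_m (a q^m, b q^m, q^{m+1};q)_∞`, which is
`(a, b, q;q)_∞` times the term `q^m (a b q^{m-2};q)_m / (q, a, b;q)_m`; written with infinite
products it makes sense for all `a` and `b`. -/
noncomputable def warnaarTerm (q a b : ℂ) (m : ℕ) : ℂ :=
  q ^ m * qPoch (a * b * q ^ m / q ^ 2) q m *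
    (qPochInf (a * q ^ m) q * qPochInf (b * q ^ m) q * qPochInf (q * q ^ m) q)

theorem exists_norm_warnaarTerm_le {q : ℂ} (hq : ‖q‖ < 1) (R : ℝ) :
    ∃ C : ℝ, ∀ a b : ℂ, ‖a‖ ≤ R → ‖b‖ ≤ R → ∀ m, ‖warnaarTerm q a b m‖ ≤ C * ‖q‖ ^ m := by
  refine ⟨Real.exp (R * R / ‖q‖ ^ 2 / (1 - ‖q‖)) * (Real.exp (R / (1 - ‖q‖)) *
    Real.exp (R / (1 - ‖q‖)) * Real.exp (1 / (1 - ‖q‖))), fun a b ha hb m => ?_⟩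
  have hR : 0 ≤ R := (norm_nonneg a).trans ha
  have hm : ‖q‖ ^ m ≤ 1 := pow_le_one₀ (norm_nonneg q) hq.le
  have h1 : ∀ {x : ℂ} {S : ℝ}, ‖x‖ ≤ S → ‖x * q ^ m‖ ≤ S := by
    intro x S hx
    rw [norm_mul, norm_pow]
    exact (mul_le_of_le_one_right (norm_nonneg x) hm).trans hx
  have h2 : ‖a * b * q ^ m / q ^ 2‖ ≤ R * R / ‖q‖ ^ 2 := by
    rw [norm_div, norm_pow q 2]
    refine div_le_div_of_nonneg_right (h1 ?_) (by positivity)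
    rw [norm_mul]
    gcongr
  rw [warnaarTerm, norm_mul, norm_mul, norm_mul, norm_mul, norm_pow,
    mul_assoc (‖q‖ ^ m), mul_comm (‖q‖ ^ m)]
  gcongr
  · exact norm_qPoch_le hq h2 m
  · exact norm_qPochInf_le hq (h1 ha)
  · exact norm_qPochInf_le hq (h1 hb)
  · exact norm_qPochInf_le hq (h1 hq.le)

theorem summable_warnaarTerm {q : ℂ} (hq : ‖q‖ < 1) (a b : ℂ) : Summable (warnaarTerm q a b) := by
  obtain ⟨C, hC⟩ := exists_norm_warnaarTerm_le hq (max ‖a‖ ‖b‖)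
  exact .of_norm_bounded ((summable_geometric_of_lt_one (norm_nonneg q) hq).mul_left C)
    (hC a b (le_max_left _ _) (le_max_right _ _))

theorem exists_norm_tsum_warnaarTerm_le {q : ℂ} (hq : ‖q‖ < 1) (R : ℝ) :
    ∃ C : ℝ, ∀ a b : ℂ, ‖a‖ ≤ R → ‖b‖ ≤ R → ‖∑' m, warnaarTerm q a b m‖ ≤ C := by
  obtain ⟨C, hC⟩ := exists_norm_warnaarTerm_le hq R
  exact ⟨_, fun a b ha hb => tsum_of_norm_bounded
    ((summable_geometric_of_lt_one (norm_nonneg q) hq).mul_left C).hasSum (hC a b ha hb)⟩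

/-- Partial sums of the recurrence for the product side in closed form. -/
theorem sum_warnaarTerm {q : ℂ} (hq0 : q ≠ 0) (hq : ‖q‖ < 1) (a b : ℂ) (n : ℕ) :
    ∑ m ∈ Finset.range (n + 2), warnaarTerm q a b m +
        (a + b) * ∑ m ∈ Finset.range (n + 1), warnaarTerm q (a * q) (b * q) m +
        a * b * q * ∑ m ∈ Finset.range n, warnaarTerm q (a * q ^ 2) (b * q ^ 2) m =
      qPoch (a * b * q ^ (n + 1)) q (n + 1) * (qPochInf (a * q ^ (n + 1)) q *
        qPochInf (b * q ^ (n + 1)) q * qPochInf (q * q ^ (n + 1)) q) := by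
  induction n with
  | zero =>
    have ha := qPochInf_eq_one_sub_mul a hq
    have hb := qPochInf_eq_one_sub_mul b hq
    have hqq := qPochInf_eq_one_sub_mul q hq
    simp only [warnaarTerm, Finset.sum_range_succ, Finset.sum_range_zero, qPoch_succ, qPoch_zero,
      pow_zero, mul_one, zero_add, pow_one]
    rw [ha, hb, hqq]
    field_simp
    ring
  | succ n ih =>
    rw [Finset.sum_range_succ (warnaarTerm q a b) (n + 2),
      Finset.sum_range_succ (warnaarTerm q (a * q) (b * q)) (n + 1),
      Finset.sum_range_succ (warnaarTerm q (a * q ^ 2) (b * q ^ 2)) n]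
    have ha := qPochInf_eq_one_sub_mul (a * q ^ (n + 1)) hq
    have hb := qPochInf_eq_one_sub_mul (b * q ^ (n + 1)) hq
    have hqq := qPochInf_eq_one_sub_mul (q * q ^ (n + 1)) hq
    -- all finite products are multiples of `E = (a b q^{n+2};q)_n`
    have e1 : qPoch (a * b * q ^ (n + 1)) q (n + 1) =
        (1 - a * b * q ^ (n + 1)) * qPoch (a * b * q ^ (n + 2)) q n := by
      rw [qPoch_succ_left, mul_assoc _ _ q, ← pow_succ]
    have e2 : qPoch (a * b * q ^ (n + 2)) q (n + 2) = qPoch (a * b * q ^ (n + 2)) q n *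
        (1 - a * b * q ^ (2 * n + 2)) * (1 - a * b * q ^ (2 * n + 3)) := by
      rw [qPoch_succ, qPoch_succ]; ring
    have e3 : qPoch (a * b * q ^ (n + 2) / q ^ 2) q (n + 2) = (1 - a * b * q ^ n) *
        (1 - a * b * q ^ (n + 1)) * qPoch (a * b * q ^ (n + 2)) q n := by
      have : a * b * q ^ (n + 2) / q ^ 2 = a * b * q ^ n := by field_simp; ring
      rw [this, qPoch_succ_left, qPoch_succ_left, mul_assoc (a * b) _ q, ← pow_succ,
        mul_assoc (a * b) _ q, ← pow_succ]
      ring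
    have e4 : a * q * (b * q) * q ^ (n + 1) / q ^ 2 = a * b * q ^ (n + 1) := by field_simp
    have e5 : a * q ^ 2 * (b * q ^ 2) * q ^ n / q ^ 2 = a * b * q ^ (n + 2) := by field_simp; ring
    have p (x : ℂ) : x * q * q ^ (n + 1) = x * q ^ (n + 2) := by ring
    have p2 (x : ℂ) : x * q ^ 2 * q ^ n = x * q ^ (n + 2) := by ring
    have p3 (x : ℂ) : x * q ^ (n + 1) * q = x * q ^ (n + 2) := by ring
    have hq1 : qPochInf (q * q ^ n) q = (1 - q ^ (n + 1)) * qPochInf (q * q ^ (n + 1)) q := by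
      rw [qPochInf_eq_one_sub_mul _ hq, mul_assoc q, ← pow_succ, ← pow_succ']
    rw [p3] at ha hb hqq
    have t0 := warnaarTerm.eq_1 q a b (n + 2)
    have t1 := warnaarTerm.eq_1 q (a * q) (b * q) (n + 1)
    have t2 := warnaarTerm.eq_1 q (a * q ^ 2) (b * q ^ 2) n
    rw [e3] at t0
    rw [e4, e1, p, p, hqq] at t1
    rw [e5, p2, p2, hq1, hqq] at t2
    rw [e1, ha, hb, hqq] at ih
    rw [t0, t1, t2, show n + 1 + 1 = n + 2 from rfl, e2]
    linear_combination ih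

theorem tsum_warnaarTerm_eq {q : ℂ} (hq0 : q ≠ 0) (hq : ‖q‖ < 1) (a b : ℂ) :
    ∑' m, warnaarTerm q a b m = 1 - (a + b) * ∑' m, warnaarTerm q (a * q) (b * q) m -
      a * b * q * ∑' m, warnaarTerm q (a * q ^ 2) (b * q ^ 2) m := by
  have s (a b : ℂ) := (summable_warnaarTerm hq a b).hasSum.tendsto_sum_nat
  have h1 := (((Filter.tendsto_add_atTop_iff_nat 2).2 (s a b)).add
    (((Filter.tendsto_add_atTop_iff_nat 1).2 (s (a * q) (b * q))).const_mul (a + b))).add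
    ((s (a * q ^ 2) (b * q ^ 2)).const_mul (a * b * q))
  simp only [sum_warnaarTerm hq0 hq] at h1
  have h2 := (tendsto_qPoch_mul_pow (a * b) hq).mul (((tendsto_qPochInf_mul_pow a hq).mul
    (tendsto_qPochInf_mul_pow b hq)).mul (tendsto_qPochInf_mul_pow q hq))
  have h3 := tendsto_nhds_unique h1 ((Filter.tendsto_add_atTop_iff_nat 1).2 h2)
  linear_combination h3

/-- A bounded solution of a two-step backward recursion whose coefficients tend to `0` vanishes. -/
theorem eq_zero_of_norm_le_mul_add {D : ℕ → ℂ} {ε : ℕ → ℝ} {C : ℝ} (hD : ∀ n, ‖D n‖ ≤ C)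
    (hε : Filter.Tendsto ε Filter.atTop (nhds 0))
    (h : ∀ n, ‖D n‖ ≤ ε n * (‖D (n + 1)‖ + ‖D (n + 2)‖)) (n : ℕ) : D n = 0 := by
  obtain ⟨N, hN⟩ := Filter.eventually_atTop.1
    (hε.eventually_le_const (show (0 : ℝ) < 1 / 4 by norm_num))
  have h1 : ∀ k : ℕ, ∀ n, N ≤ n → ‖D n‖ ≤ C * (1 / 2) ^ k := by
    intro k
    induction k with
    | zero => intro n _; simpa using hD n
    | succ k ih =>
      intro n hn
      have i1 := ih (n + 1) (by omega)
      have i2 := ih (n + 2) (by omega)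
      calc ‖D n‖ ≤ ε n * (‖D (n + 1)‖ + ‖D (n + 2)‖) := h n
        _ ≤ 1 / 4 * (C * (1 / 2) ^ k + C * (1 / 2) ^ k) := by
          gcongr
          exact hN n hn
        _ = C * (1 / 2) ^ (k + 1) := by ring
  have h2 : ∀ n, N ≤ n → D n = 0 := by
    intro n hn
    have ht : Filter.Tendsto (fun k : ℕ => C * (1 / 2 : ℝ) ^ k) Filter.atTop (nhds 0) := by
      simpa using (tendsto_pow_atTop_nhds_zero_of_lt_one (r := (1 / 2 : ℝ)) (by norm_num)
        (by norm_num)).const_mul C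
    exact norm_le_zero_iff.1 (ge_of_tendsto' ht fun k => h1 k n hn)
  have h3 : ∀ j n, N ≤ n + j → D n = 0 := by
    intro j
    induction j with
    | zero => exact fun n hn => h2 n hn
    | succ j ih =>
      intro n hn
      have := h n
      rw [ih (n + 1) (by omega), ih (n + 2) (by omega)] at this
      simpa using this
  exact h3 N n (by omega)

/-- The difference of the two sides solves a homogeneous backward recursion
along `(a q^n, b q^n)`. -/
theorem tsum_warnaarTerm {q : ℂ} (hq0 : q ≠ 0) (hq : ‖q‖ < 1) (a b : ℂ) :
    ∑' m, warnaarTerm q a b m = partialTheta q a b := by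
  obtain ⟨C, hC⟩ := exists_norm_tsum_warnaarTerm_le hq (max ‖a‖ ‖b‖)
  set L : ℂ → ℂ → ℂ := fun a b => ∑' m, warnaarTerm q a b m with hL
  let D : ℕ → ℂ := fun n => L (a * q ^ n) (b * q ^ n) - partialTheta q (a * q ^ n) (b * q ^ n)
  have hrec : ∀ n, D n = -((a + b) * q ^ n) * D (n + 1) - a * b * q * q ^ n * q ^ n * D (n + 2) := by
    intro n
    have e1 := tsum_warnaarTerm_eq hq0 hq (a * q ^ n) (b * q ^ n)
    have e2 := partialTheta_eq hq (a * q ^ n) (b * q ^ n)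
    have p1 (x : ℂ) : x * q ^ n * q = x * q ^ (n + 1) := by ring
    have p2 (x : ℂ) : x * q ^ n * q ^ 2 = x * q ^ (n + 2) := by ring
    simp only [p1, p2] at e1 e2
    simp only [D, hL]
    rw [e1, e2]
    ring
  have hn (x : ℂ) (n : ℕ) : ‖x * q ^ n‖ ≤ ‖x‖ := by
    rw [norm_mul, norm_pow]
    exact mul_le_of_le_one_right (norm_nonneg x) (pow_le_one₀ (norm_nonneg q) hq.le)
  have hb : ∀ n, ‖D n‖ ≤ C + ∑' j : ℕ, ‖q‖ ^ j.choose 2 * (2 * max ‖a‖ ‖b‖) ^ j := fun n =>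
    (norm_sub_le _ _).trans (add_le_add
      (hC _ _ ((hn a n).trans (le_max_left _ _)) ((hn b n).trans (le_max_right _ _)))
      (norm_partialTheta_le hq ((hn a n).trans (le_max_left _ _))
        ((hn b n).trans (le_max_right _ _))))
  have hε : Filter.Tendsto (fun n : ℕ => (‖a + b‖ + ‖a * b * q‖) * ‖q‖ ^ n)
      Filter.atTop (nhds 0) := by
    simpa using (tendsto_pow_atTop_nhds_zero_of_lt_one (norm_nonneg q) hq).const_mul
      (‖a + b‖ + ‖a * b * q‖)
  have hD := eq_zero_of_norm_le_mul_add hb hε (fun n => ?_) 0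
  · simpa [D, hL, sub_eq_zero] using hD
  · have hm : ‖q‖ ^ n ≤ 1 := pow_le_one₀ (norm_nonneg q) hq.le
    have t := norm_sub_le (-((a + b) * q ^ n) * D (n + 1)) (a * b * q * q ^ n * q ^ n * D (n + 2))
    rw [← hrec, norm_mul, norm_neg, norm_mul (a + b), norm_mul _ (D (n + 2)), norm_mul _ (q ^ n),
      norm_mul _ (q ^ n), norm_pow] at t
    have t1 : ‖a * b * q‖ * ‖q‖ ^ n * ‖q‖ ^ n ≤ ‖a * b * q‖ * ‖q‖ ^ n :=
      mul_le_of_le_one_right (by positivity) hm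
    have t2 := mul_le_mul_of_nonneg_right t1 (norm_nonneg (D (n + 2)))
    have t3 : 0 ≤ ‖a + b‖ * ‖q‖ ^ n * ‖D (n + 2)‖ := by positivity
    have t4 : 0 ≤ ‖a * b * q‖ * ‖q‖ ^ n * ‖D (n + 1)‖ := by positivity
    linarith

/-- Jacobi's triple product: for `a b = q`, the term `m` at `(a q^2, b q^2)` is `q^{-2}` times the
term `m + 2` at `(a, b)`, the term `1` vanishes, and the term `0` is the product. -/
theorem jacobi_triple_product {q : ℂ} (hq0 : q ≠ 0) (hq : ‖q‖ < 1) {a b : ℂ} (hab : a * b = q) :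
    qPochInf a q * qPochInf b q * qPochInf q q =
      partialTheta q a 0 + partialTheta q b 0 - 1 := by
  rw [← partialTheta_sub hq, ← tsum_warnaarTerm hq0 hq, ← tsum_warnaarTerm hq0 hq, hab,
    ← tsum_mul_left]
  have e : ∀ m, warnaarTerm q a b (m + 1 + 1) =
      q * q * warnaarTerm q (a * q ^ 2) (b * q ^ 2) m := by
    intro m
    have p (x : ℂ) : x * q ^ 2 * q ^ m = x * q ^ (m + 1 + 1) := by ring
    have e1 : a * b * q ^ (m + 1 + 1) / q ^ 2 = q * q ^ m := by rw [hab]; field_simp; ring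
    have e2 : a * q ^ 2 * (b * q ^ 2) * q ^ m / q ^ 2 = q * q ^ m * q ^ 2 := by
      rw [show a * q ^ 2 * (b * q ^ 2) = a * b * (q ^ 2 * q ^ 2) by ring, hab]; field_simp
    have e3 : qPochInf (q * q ^ m) q =
        qPoch (q * q ^ m) q 2 * qPochInf (q * q ^ (m + 1 + 1)) q := by
      rw [qPochInf_eq_mul _ hq 2]; ring_nf
    simp only [warnaarTerm, p, e1, e2]
    rw [e3, show m + 1 + 1 = 2 + m by ring, qPoch_add]
    ring
  have h := summable_warnaarTerm hq a b
  rw [h.tsum_eq_zero_add, ((summable_nat_add_iff 1).2 h).tsum_eq_zero_add]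
  simp only [e]
  simp [warnaarTerm, qPoch, hab, hq0, pow_two]

/-- A variant of Warnaar's partial theta summation: the quotient
`∑_j (-1)^j q^{j(j-1)/2} h_j(a, b) / (a, b, q;q)_∞` as a basic hypergeometric series. -/
theorem hasSum_qPoch_div {q : ℂ} (hq0 : q ≠ 0) (hq : ‖q‖ < 1) {a b : ℂ}
    (ha : ∀ j : ℕ, a * q ^ j ≠ 1) (hb : ∀ j : ℕ, b * q ^ j ≠ 1) :
    HasSum (fun m : ℕ => q ^ m * qPoch (a * b * q ^ m / q ^ 2) q m /
        (qPoch q q m * qPoch a q m * qPoch b q m))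
      (partialTheta q a b / (qPochInf a q * qPochInf b q * qPochInf q q)) := by
  have hqq := mul_pow_ne_one_of_norm_lt_one hq hq
  have h := (summable_warnaarTerm hq a b).hasSum
  rw [tsum_warnaarTerm hq0 hq] at h
  refine (h.div_const (qPochInf a q * qPochInf b q * qPochInf q q)).congr_fun fun m => ?_
  rw [warnaarTerm, div_eq_div_iff
    (mul_ne_zero (mul_ne_zero (qPoch_ne_zero hqq m) (qPoch_ne_zero ha m)) (qPoch_ne_zero hb m))
    (mul_ne_zero (mul_ne_zero (qPochInf_ne_zero hq ha) (qPochInf_ne_zero hq hb))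
      (qPochInf_ne_zero hq hqq)),
    qPochInf_eq_mul a hq m, qPochInf_eq_mul b hq m, qPochInf_eq_mul q hq m]
  ring

theorem hasSum_pow_div_qPoch {q : ℂ} (hq0 : q ≠ 0) (hq : ‖q‖ < 1) {a : ℂ}
    (ha : ∀ j : ℕ, a * q ^ j ≠ 1) :
    HasSum (fun m : ℕ => q ^ m / (qPoch q q m * qPoch a q m))
      (partialTheta q a 0 / (qPochInf a q * qPochInf q q)) := by
  simpa [qPoch_zero_left, qPochInf_zero_left] using
    hasSum_qPoch_div hq0 hq ha (b := 0) (by simp)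

/-! ### Evaluation of the four series -/

theorem hasSum_Ici {f g : ℕ → ℂ} {s t : ℂ} (k : ℕ) (h : HasSum g t)
    (hfg : ∀ m, f (k + m) = g m) (hst : s = t) : HasSum (fun n : Set.Ici k => f n) s := by
  let e : ℕ ≃ Set.Ici k :=
    { toFun := fun m => ⟨k + m, Nat.le_add_right k m⟩
      invFun := fun n => n - k
      left_inv := fun m => Nat.add_sub_cancel_left k m
      right_inv := fun n => Subtype.ext (Nat.add_sub_cancel' n.2) }
  rw [hst]
  exact e.hasSum_iff.1 (h.congr_fun hfg)

theorem mul_mul_pow_ne_one {q z : ℂ}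
    (hz : ∀ m : ℤ, m ≠ 0 → z ≠ q ^ m) (j : ℕ) : q * z * q ^ j ≠ 1 := by
  intro h
  refine hz (-((j + 1 : ℕ) : ℤ)) (by omega) ?_
  rw [zpow_neg, zpow_natCast, eq_comm, inv_eq_iff_eq_inv, eq_comm]
  refine inv_eq_of_mul_eq_one_right ?_
  rw [← h]
  ring

theorem div_mul_pow_ne_one {q z : ℂ} (hz0 : z ≠ 0)
    (hz : ∀ m : ℤ, m ≠ 0 → z ≠ q ^ m) (j : ℕ) : q / z * q ^ j ≠ 1 := by
  intro h
  refine hz ((j + 1 : ℕ) : ℤ) (by omega) ?_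
  rw [zpow_natCast]
  field_simp at h
  rw [pow_succ', h]

theorem mul_pow_mul_pow_ne_one {a q : ℂ} (h : ∀ j : ℕ, a * q ^ j ≠ 1) (k j : ℕ) :
    a * q ^ k * q ^ j ≠ 1 := by
  rw [mul_assoc, ← pow_add]
  exact h _

section Evaluation

variable {q z : ℂ}

theorem hasSum_termII₁ (hq0 : q ≠ 0) (hq : ‖q‖ < 1) (hz0 : z ≠ 0)
    (hz : ∀ m : ℤ, m ≠ 0 → z ≠ q ^ m) (k : ℕ) :
    HasSum (fun n : Set.Ici k => termII₁ k q z n)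
      (q ^ (k + k.choose 2) / z ^ k * partialTheta q (q / z * q ^ k) 0 /
        (qPochInf (q * z) q * qPochInf (q / z) q * qPochInf q q)) := by
  have hb := div_mul_pow_ne_one hz0 hz
  have h := (hasSum_pow_div_qPoch hq0 hq (mul_pow_mul_pow_ne_one hb k)).mul_left
    (q ^ (k + k.choose 2) / z ^ k / (qPochInf (q * z) q * qPoch (q / z) q k))
  refine hasSum_Ici (f := termII₁ k q z) k h (fun m => ?_) ?_
  · rw [termII₁, Nat.add_sub_cancel_left, qPoch_add, zpow_neg, zpow_natCast]
    simp only [div_eq_mul_inv, mul_inv]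
    ring
  · rw [qPochInf_eq_mul (q / z) hq k]
    simp only [div_eq_mul_inv, mul_inv]
    ring

theorem hasSum_termII₂ (hq0 : q ≠ 0) (hq : ‖q‖ < 1)
    (hz : ∀ m : ℤ, m ≠ 0 → z ≠ q ^ m) (k : ℕ) :
    HasSum (fun n : Set.Ici (k + 1) => termII₂ (k + 1) q z n)
      (q ^ (k + 1).choose 2 * z ^ (k + 1) * partialTheta q (q * z * q ^ k) 0 /
        (qPochInf (q * z) q * qPochInf (q / z) q * qPochInf q q)) := by
  have ha := mul_mul_pow_ne_one hz
  have h := (hasSum_pow_div_qPoch hq0 hq (mul_pow_mul_pow_ne_one ha k)).mul_left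
    (q ^ (k + 1).choose 2 * z ^ (k + 1) / (qPochInf (q / z) q * qPoch (q * z) q k))
  refine hasSum_Ici (f := termII₂ (k + 1) q z) (k + 1) h (fun m => ?_) ?_
  · rw [termII₂, Nat.add_sub_cancel_left, show k + 1 + m - 1 = k + m by omega, qPoch_add]
    simp only [div_eq_mul_inv, mul_inv]
    ring
  · rw [qPochInf_eq_mul (q * z) hq k]
    simp only [div_eq_mul_inv, mul_inv]
    ring

theorem hasSum_termI₂ (hq0 : q ≠ 0) (hq : ‖q‖ < 1) (hz0 : z ≠ 0)
    (hz : ∀ m : ℤ, m ≠ 0 → z ≠ q ^ m) (k : ℕ) :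
    HasSum (fun n : Set.Ici k => termI₂ k q z n)
      (q ^ (k + k.choose 2) * (z ^ 2 / z ^ k) * partialTheta q (q * z * q ^ k) 0 /
        (qPochInf (q * z) q * qPochInf (q / z) q * qPochInf q q)) := by
  have ha := mul_mul_pow_ne_one hz
  have h := (hasSum_pow_div_qPoch hq0 hq (mul_pow_mul_pow_ne_one ha k)).mul_left
    (q ^ (k + k.choose 2) * (z ^ 2 / z ^ k) / (qPochInf (q / z) q * qPoch (q * z) q k))
  refine hasSum_Ici (f := termI₂ k q z) k h (fun m => ?_) ?_
  · rw [termI₂, Nat.add_sub_cancel_left, qPoch_add, zpow_sub₀ hz0, zpow_natCast, zpow_ofNat]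
    simp only [div_eq_mul_inv, mul_inv]
    ring
  · rw [qPochInf_eq_mul (q * z) hq k]
    simp only [div_eq_mul_inv, mul_inv]
    ring

theorem hasSum_termI₁ (hq0 : q ≠ 0) (hq : ‖q‖ < 1) (hz0 : z ≠ 0)
    (hz : ∀ m : ℤ, m ≠ 0 → z ≠ q ^ m) {k : ℕ} (hk : 1 ≤ k) :
    HasSum (fun n : Set.Ici k => termI₁ k q z n)
      (q ^ (k + k.choose 2) * ((1 + z) / z ^ k) *
        partialTheta q (q * z * q ^ k) (q / z * q ^ k) /
        (qPochInf (q * z) q * qPochInf (q / z) q * qPochInf q q)) := by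
  have ha := mul_mul_pow_ne_one hz
  have hb := div_mul_pow_ne_one hz0 hz
  have h := (hasSum_qPoch_div hq0 hq (mul_pow_mul_pow_ne_one ha k)
    (mul_pow_mul_pow_ne_one hb k)).mul_left
    (q ^ (k + k.choose 2) * ((1 + z) / z ^ k) / (qPoch (q / z) q k * qPoch (q * z) q k))
  refine hasSum_Ici (f := termI₁ k q z) k h (fun m => ?_) ?_
  · have e1 : q * z * q ^ k * (q / z * q ^ k) * q ^ m / q ^ 2 = q * q ^ (2 * k + m - 1) := by
      rw [← pow_succ', show 2 * k + m - 1 + 1 = 2 * k + m by omega]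
      field_simp
      ring
    have e2 : qPoch q q (2 * (k + m) - 1) =
        qPoch q q (2 * k + m - 1) * qPoch (q * q ^ (2 * k + m - 1)) q m := by
      rw [← qPoch_add]
      congr 1
      omega
    have hne : qPoch q q (2 * k + m - 1) ≠ 0 :=
      qPoch_ne_zero (mul_pow_ne_one_of_norm_lt_one hq hq) _
    have e3 : qBinom (2 * (k + m) - 1) m q =
        qPoch (q * q ^ (2 * k + m - 1)) q m / qPoch q q m := by
      rw [qBinom, if_pos (by omega), e2, show 2 * (k + m) - 1 - m = 2 * k + m - 1 by omega,
        mul_comm (qPoch q q m), mul_div_mul_left _ _ hne]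
    rw [termI₁, Nat.add_sub_cancel_left, qPoch_add, qPoch_add, zpow_neg, zpow_natCast, e1, e3]
    simp only [div_eq_mul_inv, mul_inv]
    ring
  · rw [qPochInf_eq_mul (q * z) hq k, qPochInf_eq_mul (q / z) hq k]
    simp only [div_eq_mul_inv, mul_inv]
    ring

/-! ### The truncated theta series -/

theorem int_mul_sub_one_div_two (n : ℕ) : (n : ℤ) * (n - 1) / 2 = (n.choose 2 : ℕ) := by
  refine Int.ediv_eq_of_eq_mul_right two_ne_zero ?_
  induction n with
  | zero => simp
  | succ n ih =>
    rw [choose_succ_two]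
    push_cast at ih ⊢
    linarith

theorem nat_mul_succ_div_two (n : ℕ) : n * (n + 1) / 2 = n.choose 2 + n := by
  rw [← choose_succ_two, Nat.choose_two_right, Nat.add_sub_cancel, mul_comm]

/-- The terms with `n ≥ 0` and those with `n ≤ 0` are truncated partial theta series in `z` and
in `q / z`; the term `n = 0` is counted twice. -/
theorem sum_Ioo_theta (k : ℕ) :
    ∑ n ∈ Finset.Ioo (-((k + 1 : ℕ) : ℤ)) ((k + 1 : ℕ) : ℤ),
        (-1) ^ n * q ^ (n * (n - 1) / 2) * z ^ n =
      ∑ j ∈ Finset.range (k + 1), (-1) ^ j * q ^ j.choose 2 * z ^ j +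
        ∑ j ∈ Finset.range (k + 1), (-1) ^ j * q ^ j.choose 2 * (q / z) ^ j - 1 := by
  induction k with
  | zero =>
    have : Finset.Ioo (-((0 + 1 : ℕ) : ℤ)) ((0 + 1 : ℕ) : ℤ) = {0} := by decide
    rw [this]
    simp
  | succ k ih =>
    have e : Finset.Ioo (-((k + 1 + 1 : ℕ) : ℤ)) ((k + 1 + 1 : ℕ) : ℤ) =
        insert ((k + 1 : ℕ) : ℤ) (insert (-((k + 1 : ℕ) : ℤ))
          (Finset.Ioo (-((k + 1 : ℕ) : ℤ)) ((k + 1 : ℕ) : ℤ))) := by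
      ext n
      simp only [Finset.mem_insert, Finset.mem_Ioo]
      push_cast
      omega
    have e1 : -((k + 1 : ℕ) : ℤ) * (-((k + 1 : ℕ) : ℤ) - 1) / 2 =
        ((k + 1 + 1).choose 2 : ℕ) := by
      rw [← int_mul_sub_one_div_two]
      congr 1
      push_cast
      ring
    rw [e, Finset.sum_insert (by simp; omega), Finset.sum_insert (by simp), ih,
      int_mul_sub_one_div_two, e1, Finset.sum_range_succ _ (k + 1),
      Finset.sum_range_succ _ (k + 1), choose_succ_two (k + 1)]
    simp only [zpow_natCast, zpow_neg]
    have h1 : ((-1 : ℂ) ^ (k + 1))⁻¹ = (-1) ^ (k + 1) := by rw [← inv_pow]; norm_num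
    rw [h1, div_pow]
    simp only [div_eq_mul_inv]
    ring

theorem sum_range_theta (hz0 : z ≠ 0) (k : ℕ) :
    ∑ n ∈ Finset.range k, (-1) ^ n * q ^ (n * (n + 1) / 2) * z ^ (-(n : ℤ)) *
        (1 - z ^ (2 * n + 1)) =
      ∑ j ∈ Finset.range k, (-1) ^ j * q ^ j.choose 2 * (q / z) ^ j -
        z * ∑ j ∈ Finset.range k, (-1) ^ j * q ^ j.choose 2 * (q * z) ^ j := by
  rw [Finset.mul_sum, ← Finset.sum_sub_distrib]
  refine Finset.sum_congr rfl fun n _ => ?_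
  rw [nat_mul_succ_div_two, zpow_neg, zpow_natCast, div_pow]
  field_simp
  ring

/-- The triple product with the factor `1 - z` of `(z;q)_∞` split off, so that it can
be divided by the remaining product even when `z = 1`. -/
theorem jacobi_triple_product_mul (hq0 : q ≠ 0) (hq : ‖q‖ < 1) (hz0 : z ≠ 0) :
    (1 - z) * (qPochInf (q * z) q * qPochInf (q / z) q * qPochInf q q) =
      partialTheta q z 0 + partialTheta q (q / z) 0 - 1 := by
  rw [← jacobi_triple_product hq0 hq (mul_div_cancel₀ q hz0), qPochInf_eq_one_sub_mul z hq,
    mul_comm z q]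
  ring

theorem product_ne_zero (hq : ‖q‖ < 1) (hz0 : z ≠ 0)
    (hz : ∀ m : ℤ, m ≠ 0 → z ≠ q ^ m) :
    qPochInf (q * z) q * qPochInf (q / z) q * qPochInf q q ≠ 0 :=
  mul_ne_zero (mul_ne_zero (qPochInf_ne_zero hq (mul_mul_pow_ne_one hz))
    (qPochInf_ne_zero hq (div_mul_pow_ne_one hz0 hz)))
    (qPochInf_ne_zero hq (mul_pow_ne_one_of_norm_lt_one hq hq))

/-- After evaluation of the series, both sides are the difference between the triple product and
the first terms of the partial theta functions of `z` and of `q / z`. -/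
theorem truncated_identity_two (hq0 : q ≠ 0) (hq : ‖q‖ < 1) (hz0 : z ≠ 0)
    (hz : ∀ m : ℤ, m ≠ 0 → z ≠ q ^ m) (k : ℕ) :
    (-1) ^ k / (qPochInf (q * z) q * qPochInf (q / z) q * qPochInf q q) *
          (∑ n ∈ Finset.Ioo (-((k + 1 : ℕ) : ℤ)) ((k + 1 : ℕ) : ℤ),
            (-1) ^ n * q ^ (n * (n - 1) / 2) * z ^ n) - (-1) ^ k * (1 - z) =
      (∑' n : Set.Ici (k + 1), termII₁ (k + 1) q z n) +
        ∑' n : Set.Ici (k + 1), termII₂ (k + 1) q z n := by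
  rw [(hasSum_termII₁ hq0 hq hz0 hz (k + 1)).tsum_eq, (hasSum_termII₂ hq0 hq hz k).tsum_eq,
    sum_Ioo_theta]
  have hP := product_ne_zero hq hz0 hz
  have hJ := jacobi_triple_product_mul hq0 hq hz0
  have h1 := partialTheta_zero_right_eq_sum_add hq z (k + 1)
  have h2 := partialTheta_zero_right_eq_sum_add hq (q / z) (k + 1)
  set P := qPochInf (q * z) q * qPochInf (q / z) q * qPochInf q q
  rw [h1, h2] at hJ
  set S := ∑ j ∈ Finset.range (k + 1), (-1) ^ j * q ^ j.choose 2 * z ^ j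
  set S' := ∑ j ∈ Finset.range (k + 1), (-1) ^ j * q ^ j.choose 2 * (q / z) ^ j
  rw [show z * q ^ (k + 1) = q * z * q ^ k by ring] at hJ
  set A := partialTheta q (q * z * q ^ k) 0
  set B := partialTheta q (q / z * q ^ (k + 1)) 0
  have hs : ((-1 : ℂ) ^ k) * (-1) ^ k = 1 := by rw [← mul_pow]; norm_num
  rw [div_pow] at hJ
  rw [← sub_eq_zero, ← mul_left_inj' hP, zero_mul]
  have : ((-1) ^ k / P * (S + S' - 1) - (-1) ^ k * (1 - z) -
      (q ^ (k + 1 + (k + 1).choose 2) / z ^ (k + 1) * B / P +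
        q ^ (k + 1).choose 2 * z ^ (k + 1) * A / P)) * P =
      (-1) ^ k * (S + S' - 1) - (-1) ^ k * ((1 - z) * P) -
      (q ^ (k + 1).choose 2 * (q ^ (k + 1) / z ^ (k + 1)) * B +
        q ^ (k + 1).choose 2 * z ^ (k + 1) * A) := by
    field_simp
    ring
  rw [this, hJ]
  linear_combination (q ^ (k + 1).choose 2 * (q ^ (k + 1) / z ^ (k + 1)) * B +
        q ^ (k + 1).choose 2 * z ^ (k + 1) * A) * hs

/-- The two-variable partial theta function at `(q^{k+2} z, q^{k+2} / z)` is a combination of two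
one-variable ones; one of these cancels part of the second series, and what remains is the tail of
the theta series. -/
theorem truncated_identity_one (hq0 : q ≠ 0) (hq : ‖q‖ < 1) (hz0 : z ≠ 0)
    (hz : ∀ m : ℤ, z ≠ q ^ m) (k : ℕ) :
    (-1) ^ k / (qPochInf z q * qPochInf (q / z) q * qPochInf q q) *
          (∑ n ∈ Finset.range (k + 1),
            (-1) ^ n * q ^ (n * (n + 1) / 2) * z ^ (-(n : ℤ)) * (1 - z ^ (2 * n + 1))) -
        (-1) ^ k =
      (∑' n : Set.Ici (k + 1), termI₁ (k + 1) q z n) +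
        (1 - z ^ (2 * k + 1)) / (1 - z) * ∑' n : Set.Ici (k + 1), termI₂ (k + 1) q z n := by
  have hz' : ∀ m : ℤ, m ≠ 0 → z ≠ q ^ m := fun m _ => hz m
  have hz1 : 1 - z ≠ 0 := sub_ne_zero.2 (by simpa using (hz 0).symm)
  rw [(hasSum_termI₁ hq0 hq hz0 hz' (Nat.le_add_left 1 k)).tsum_eq,
    (hasSum_termI₂ hq0 hq hz0 hz' (k + 1)).tsum_eq, sum_range_theta hz0,
    qPochInf_eq_one_sub_mul z hq, mul_comm z q]
  have hP := product_ne_zero hq hz0 hz'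
  have hJ := jacobi_triple_product_mul hq0 hq hz0
  have h0 := partialTheta_zero_right_eq hq z
  rw [mul_comm z q] at h0
  have h1 := partialTheta_zero_right_eq_sum_add hq (q * z) (k + 1)
  have h2 := partialTheta_zero_right_eq_sum_add hq (q / z) (k + 1)
  have hT := sub_mul_partialTheta hq (q * z * q ^ (k + 1)) (q / z * q ^ (k + 1))
  rw [mul_assoc, mul_assoc, ← mul_assoc (qPochInf (q * z) q)]
  set P := qPochInf (q * z) q * qPochInf (q / z) q * qPochInf q q
  rw [h0, h1, h2] at hJ
  set S := ∑ j ∈ Finset.range (k + 1), (-1) ^ j * q ^ j.choose 2 * (q * z) ^ j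
  set S' := ∑ j ∈ Finset.range (k + 1), (-1) ^ j * q ^ j.choose 2 * (q / z) ^ j
  set T := partialTheta q (q * z * q ^ (k + 1)) (q / z * q ^ (k + 1))
  set A := partialTheta q (q * z * q ^ (k + 1)) 0
  set B := partialTheta q (q / z * q ^ (k + 1)) 0
  -- `(a - b) T = a A - b B` at `a = q^{k+2} z`, `b = q^{k+2} / z`, cleared of denominators
  have hT' : (1 + z) * (1 - z) * T = B - z ^ 2 * A := by
    have : q * q ^ (k + 1) ≠ 0 := mul_ne_zero hq0 (pow_ne_zero _ hq0)
    refine mul_left_cancel₀ this ?_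
    field_simp at hT
    linear_combination (-q * q ^ (k + 1)) * hT
  have hs : ((-1 : ℂ) ^ k) * (-1) ^ k = 1 := by rw [← mul_pow]; norm_num
  rw [div_pow] at hJ
  have hzz := mul_ne_zero hz1 hP
  rw [← sub_eq_zero, ← mul_left_inj' hzz, zero_mul]
  have : ((-1) ^ k / ((1 - z) * P) * (S' - z * S) - (-1) ^ k -
      (q ^ (k + 1 + (k + 1).choose 2) * ((1 + z) / z ^ (k + 1)) * T / P +
        (1 - z ^ (2 * k + 1)) / (1 - z) *
          (q ^ (k + 1 + (k + 1).choose 2) * (z ^ 2 / z ^ (k + 1)) * A / P))) * ((1 - z) * P) =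
      (-1) ^ k * (S' - z * S) - (-1) ^ k * ((1 - z) * P) -
      q ^ (k + 1 + (k + 1).choose 2) / z ^ (k + 1) * ((1 + z) * (1 - z) * T +
        (1 - z ^ (2 * k + 1)) * z ^ 2 * A) := by
    field_simp
  rw [this, hJ, hT']
  have hsq : (q ^ (k + 1).choose 2 * (q ^ (k + 1) / z ^ (k + 1)) * B -
      q ^ (k + 1).choose 2 * z * (q * z) ^ (k + 1) * A) * (((-1 : ℂ) ^ k) * (-1) ^ k) =
      q ^ (k + 1 + (k + 1).choose 2) / z ^ (k + 1) * (B - z ^ 2 * A +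
        (1 - z ^ (2 * k + 1)) * z ^ 2 * A) := by
    rw [hs]
    field_simp
    ring
  linear_combination hsq

end Evaluation

/-! ### Generating functions of families of monomials -/

/-- The domain of the expansions: `0 < |q| < 1` and `|q| < |z| < 1/|q|`, the point `z = 1`
included. -/
def ExpansionDomain (q z : ℂ) : Prop := 0 < ‖q‖ ∧ ‖q‖ < 1 ∧ ‖q‖ < ‖z‖ ∧ ‖z‖ < 1 / ‖q‖

/-- `F` is the sum of a family of monomials `q^n z^m` with `n ≥ 0`, `m ∈ ℤ`, that is, a Laurent
series whose coefficients are natural numbers. Keeping an arbitrary index type makes sums and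
products of such functions immediate: they correspond to disjoint unions and to products of index
types, without any regrouping. -/
def IsMonomialSeries (F : ℂ → ℂ → ℂ) : Prop :=
  ∃ (ι : Type) (N : ι → ℕ) (M : ι → ℤ), ∀ q z : ℂ, ExpansionDomain q z →
    HasSum (fun i => q ^ N i * z ^ M i) (F q z)

namespace ExpansionDomain

variable {q z : ℂ}

theorem q_ne_zero (h : ExpansionDomain q z) : q ≠ 0 := norm_pos_iff.1 h.1

theorem z_ne_zero (h : ExpansionDomain q z) : z ≠ 0 := norm_pos_iff.1 (h.1.trans h.2.2.1)

theorem norm_mul_lt_one (h : ExpansionDomain q z) : ‖q * z‖ < 1 := by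
  rw [norm_mul, mul_comm]
  exact (lt_div_iff₀ h.1).1 h.2.2.2

theorem norm_div_lt_one (h : ExpansionDomain q z) : ‖q / z‖ < 1 := by
  rw [norm_div]
  exact (div_lt_one (h.1.trans h.2.2.1)).2 h.2.2.1

theorem ne_zpow (h : ExpansionDomain q z) (m : ℤ) (hm : m ≠ 0) : z ≠ q ^ m := by
  obtain ⟨h0, h1, h2, h3⟩ := h
  rintro rfl
  rw [norm_zpow] at h2 h3
  rw [one_div, ← zpow_neg_one] at h3
  have i2 := (zpow_lt_zpow_iff_right_of_lt_one₀ h0 h1 (m := 1) (n := m)).1 (by simpa using h2)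
  have i3 := (zpow_lt_zpow_iff_right_of_lt_one₀ h0 h1).1 h3
  omega

/-- The domain contains the real point `(|q|, |z|)`, at which all monomials are positive. -/
theorem norm (h : ExpansionDomain q z) : ExpansionDomain (‖q‖ : ℂ) (‖z‖ : ℂ) := by
  simpa [ExpansionDomain] using h

end ExpansionDomain

namespace IsMonomialSeries

theorem congr {F G : ℂ → ℂ → ℂ} (hF : IsMonomialSeries F)
    (h : ∀ q z, ExpansionDomain q z → F q z = G q z) : IsMonomialSeries G := by
  obtain ⟨ι, N, M, hs⟩ := hF
  exact ⟨ι, N, M, fun q z hd => h q z hd ▸ hs q z hd⟩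

theorem monomial (n : ℕ) (m : ℤ) : IsMonomialSeries fun q z => q ^ n * z ^ m :=
  ⟨Unit, fun _ => n, fun _ => m, fun q z _ => by
    simp⟩

theorem zero : IsMonomialSeries fun _ _ => 0 :=
  ⟨Empty, Empty.elim, Empty.elim, fun _ _ _ => hasSum_empty⟩

theorem one : IsMonomialSeries fun _ _ => 1 := (monomial 0 0).congr fun q z _ => by simp

theorem mul {F G : ℂ → ℂ → ℂ} (hF : IsMonomialSeries F) (hG : IsMonomialSeries G) :
    IsMonomialSeries fun q z => F q z * G q z := by
  obtain ⟨ι, N, M, hs⟩ := hF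
  obtain ⟨κ, N', M', hs'⟩ := hG
  refine ⟨ι × κ, fun p => N p.1 + N' p.2, fun p => M p.1 + M' p.2, fun q z hd => ?_⟩
  have h := hs q z hd
  have h' := hs' q z hd
  have hsum := summable_mul_of_summable_norm (f := fun i => q ^ N i * z ^ M i)
    (g := fun i => q ^ N' i * z ^ M' i) h.summable.norm h'.summable.norm
  refine (h.mul h' hsum).congr_fun fun p => ?_
  dsimp only
  rw [pow_add, zpow_add₀ hd.z_ne_zero]
  ring

/-- Closure under infinite sums. Absolute summability of the combined family is read off at the
real point `(|q|, |z|)`. -/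
theorem hasSum {κ : Type} {F : κ → ℂ → ℂ → ℂ} {G : ℂ → ℂ → ℂ}
    (hF : ∀ n, IsMonomialSeries (F n))
    (hG : ∀ q z, ExpansionDomain q z → HasSum (fun n => F n q z) (G q z)) :
    IsMonomialSeries G := by
  choose ι N M hs using hF
  refine ⟨Σ n, ι n, fun p => N p.1 p.2, fun p => M p.1 p.2, fun q z hd => ?_⟩
  have hsum : Summable fun p : Σ n, ι n => q ^ N p.1 p.2 * z ^ M p.1 p.2 := by
    refine Summable.of_norm ((summable_sigma_of_nonneg fun p => norm_nonneg _).2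
      ⟨fun n => (hs n q z hd).summable.norm, ?_⟩)
    have h1 : ∀ n, ((∑' i, ‖q ^ N n i * z ^ M n i‖ : ℝ) : ℂ) = F n (‖q‖ : ℂ) (‖z‖ : ℂ) := by
      intro n
      rw [← (hs n _ _ hd.norm).tsum_eq, Complex.ofReal_tsum]
      simp
    rw [← Complex.summable_ofReal]
    exact (hG _ _ hd.norm).summable.congr fun n => (h1 n).symm
  have h2 := hsum.hasSum
  have h3 := h2.sigma fun n => hs n q z hd
  rwa [(hG q z hd).unique h3]

theorem add {F G : ℂ → ℂ → ℂ} (hF : IsMonomialSeries F) (hG : IsMonomialSeries G) :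
    IsMonomialSeries fun q z => F q z + G q z :=
  hasSum (κ := Bool) (F := fun b => if b then F else G) (fun b => by cases b <;> simpa)
    fun q z _ => by
      simpa using hasSum_fintype fun b : Bool => (if b then F else G) q z

theorem sum {F : ℕ → ℂ → ℂ → ℂ} (hF : ∀ n, IsMonomialSeries (F n)) (n : ℕ) :
    IsMonomialSeries fun q z => ∑ j ∈ Finset.range n, F j q z := by
  induction n with
  | zero => simpa using zero
  | succ n ih => simpa only [Finset.sum_range_succ] using ih.add (hF n)

theorem inv_one_sub {n : ℕ} {m : ℤ}
    (h : ∀ q z, ExpansionDomain q z → ‖q ^ n * z ^ m‖ < 1) :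
    IsMonomialSeries fun q z => (1 - q ^ n * z ^ m)⁻¹ := by
  refine ⟨ℕ, fun j => n * j, fun j => m * j, fun q z hd => ?_⟩
  refine (hasSum_geometric_of_norm_lt_one (h q z hd)).congr_fun fun j => ?_
  rw [mul_pow, pow_mul, zpow_mul, zpow_natCast]

theorem inv_qPoch {n : ℕ} {m : ℤ} (h : ∀ q z, ExpansionDomain q z → ‖q ^ n * z ^ m‖ < 1)
    (l : ℕ) : IsMonomialSeries fun q z => (qPoch (q ^ n * z ^ m) q l)⁻¹ := by
  induction l with
  | zero => simpa [qPoch_zero] using one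
  | succ l ih =>
    refine (ih.mul (inv_one_sub (n := n + l) (m := m) fun q z hd => ?_)).congr fun q z _ => ?_
    · rw [pow_add, mul_right_comm, norm_mul, norm_pow]
      exact (mul_le_of_le_one_right (norm_nonneg _)
        (pow_le_one₀ (norm_nonneg q) hd.2.1.le)).trans_lt (h q z hd)
    · rw [qPoch_succ, mul_inv, pow_add, mul_right_comm]

/-- The expansion `1 / (x;q)_∞ = 1 + ∑_{l ≥ 0} x q^l / (x;q)_{l+1}` reduces infinite products to
finite ones; it is the telescoping of `1 / (x;q)_{l+1} - 1 / (x;q)_l`. -/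
theorem inv_qPochInf {n : ℕ} {m : ℤ} (h : ∀ q z, ExpansionDomain q z → ‖q ^ n * z ^ m‖ < 1) :
    IsMonomialSeries fun q z => (qPochInf (q ^ n * z ^ m) q)⁻¹ := by
  have h1 : IsMonomialSeries fun q z => (qPochInf (q ^ n * z ^ m) q)⁻¹ - 1 := by
    refine hasSum (κ := ℕ)
      (fun l => (monomial (n + l) m).mul (inv_qPoch h (l + 1))) fun q z hd => ?_
    set x := q ^ n * z ^ m
    have hq := hd.2.1
    have hx := mul_pow_ne_one_of_norm_lt_one (h q z hd) hq
    have e : ∀ l : ℕ, q ^ (n + l) * z ^ m * (qPoch x q (l + 1))⁻¹ =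
        (qPoch x q (l + 1))⁻¹ - (qPoch x q l)⁻¹ := by
      intro l
      have h2 := qPoch_ne_zero hx l
      have h3 : 1 - x * q ^ l ≠ 0 := sub_ne_zero.2 (hx l).symm
      rw [qPoch_succ, show q ^ (n + l) * z ^ m = x * q ^ l by simp only [x]; ring]
      field_simp
      ring
    have ht : Filter.Tendsto (fun l => (qPoch x q l)⁻¹) Filter.atTop (nhds (qPochInf x q)⁻¹) :=
      (tendsto_qPoch x hq).inv₀ (qPochInf_ne_zero hq hx)
    obtain ⟨C, hC⟩ := ht.norm.bddAbove_range
    have hs : Summable fun l : ℕ => q ^ (n + l) * z ^ m * (qPoch x q (l + 1))⁻¹ := by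
      refine .of_norm_bounded ((summable_geometric_of_lt_one (norm_nonneg q) hq).mul_left
        (‖x‖ * C)) fun l => ?_
      rw [show q ^ (n + l) * z ^ m = x * q ^ l by simp only [x]; ring, norm_mul, norm_mul,
        norm_pow, mul_right_comm]
      gcongr
      exact hC ⟨l + 1, rfl⟩
    rw [hs.hasSum_iff_tendsto_nat]
    simp only [e, Finset.sum_range_sub (fun l => (qPoch x q l)⁻¹), qPoch_zero, inv_one]
    exact ht.sub_const 1
  exact (h1.add one).congr fun q z _ => by ring

theorem qBinom (n k : ℕ) : IsMonomialSeries fun q _ => _root_.qBinom n k q := by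
  induction n generalizing k with
  | zero =>
    cases k with
    | zero => simpa [_root_.qBinom, qPoch_zero] using one
    | succ k => simpa [_root_.qBinom] using zero
  | succ n ih =>
    cases k with
    | zero =>
      refine one.congr fun q z hd => ?_
      have := qPoch_ne_zero (mul_pow_ne_one_of_norm_lt_one hd.2.1 hd.2.1) (n + 1)
      simp [_root_.qBinom, qPoch_zero, this]
    | succ k =>
      refine ((ih k).add ((monomial (k + 1) 0).mul (ih (k + 1)))).congr fun q z hd => ?_
      have hne := qPoch_ne_zero (mul_pow_ne_one_of_norm_lt_one hd.2.1 hd.2.1)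
      simp only [zpow_zero, mul_one, _root_.qBinom]
      rcases lt_trichotomy n k with hlt | rfl | hlt
      · rw [if_neg (by omega), if_neg (by omega), if_neg (by omega)]
        simp
      · rw [if_pos le_rfl, if_neg (by omega), if_pos le_rfl, Nat.sub_self, Nat.sub_self]
        have h1 := hne n
        have h2 := hne (n + 1)
        simp [qPoch_zero, h1, h2]
      · obtain ⟨d, rfl⟩ := Nat.exists_eq_add_of_lt hlt
        rw [if_pos (by omega), if_pos (by omega), if_pos (by omega),
          show k + d + 1 - k = d + 1 by omega, show k + d + 1 - (k + 1) = d by omega,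
          show k + d + 1 + 1 - (k + 1) = d + 1 by omega, qPoch_succ q q (k + d + 1),
          qPoch_succ q q k, qPoch_succ q q d]
        have h1 := hne k
        have h2 := hne d
        have h3 := hne (k + 1)
        have h4 := hne (d + 1)
        rw [qPoch_succ] at h3 h4
        have h5 := right_ne_zero_of_mul h3
        have h6 := right_ne_zero_of_mul h4
        field_simp
        ring

/-- Grouping equal monomials: the coefficient of `q^n z^m` is the number of indices with that
monomial. It is finite because a convergent series has only finitely many terms equal to a given
non-zero number. -/
theorem hasNonnegExpansion {F G : ℂ → ℂ → ℂ} (hF : IsMonomialSeries F)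
    (h : ∀ q z, ExpansionDomain q z → z ≠ 1 → F q z = G q z) : HasNonnegExpansion G := by
  obtain ⟨ι, N, M, hs⟩ := hF
  refine ⟨fun n m => (Nat.card {i // (N i, M i) = (n, m)} : ℝ), fun n m => Nat.cast_nonneg _,
    fun q z h0 h1 h2 h3 hz => ?_⟩
  have hd : ExpansionDomain q z := ⟨h0, h1, h2, h3⟩
  rw [← h q z hd hz]
  have hσ := (Equiv.sigmaFiberEquiv fun i => (N i, M i)).hasSum_iff.2 (hs q z hd)
  have h4 := hσ.sigma fun p => (hσ.summable.sigma_factor p).hasSum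
  refine h4.congr_fun fun p => ?_
  have h5 : ∀ i : {i // (N i, M i) = p},
      q ^ N i.1 * z ^ M i.1 = q ^ p.1 * z ^ p.2 := by
    rintro ⟨i, rfl⟩
    rfl
  simp only [Function.comp_apply, Equiv.sigmaFiberEquiv_apply, h5, tsum_const, nsmul_eq_mul]
  push_cast
  ring

end IsMonomialSeries

/-! ### Expansions of the four series -/

section Expansions

variable (k : ℕ)

theorem norm_q_mul_lt_one (q z : ℂ) (hd : ExpansionDomain q z) : ‖q ^ 1 * z ^ (1 : ℤ)‖ < 1 := by
  simpa using hd.norm_mul_lt_one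

theorem norm_q_div_lt_one (q z : ℂ) (hd : ExpansionDomain q z) :
    ‖q ^ 1 * z ^ (-1 : ℤ)‖ < 1 := by
  simpa [div_eq_mul_inv] using hd.norm_div_lt_one

theorem norm_q_lt_one (q z : ℂ) (hd : ExpansionDomain q z) : ‖q ^ 1 * z ^ (0 : ℤ)‖ < 1 := by
  simpa using hd.2.1

open IsMonomialSeries in
theorem isMonomialSeries_termI₁ (n : ℕ) : IsMonomialSeries fun q z => termI₁ k q z n := by
  refine (((((monomial (n + k.choose 2) (-k)).mul (one.add (monomial 0 1))).mul
    (inv_qPoch norm_q_div_lt_one n)).mul (inv_qPoch norm_q_mul_lt_one n)).mul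
    (IsMonomialSeries.qBinom (2 * n - 1) (n - k))).congr fun q z _ => ?_
  simp only [termI₁, pow_one, pow_zero, zpow_one, zpow_neg_one, ← div_eq_mul_inv, one_mul]
  rw [div_div]
  ring

open IsMonomialSeries in
theorem isMonomialSeries_termI₂ (n : ℕ) : IsMonomialSeries fun q z => termI₂ k q z n := by
  refine ((((monomial (n + k.choose 2) (2 - k)).mul (inv_qPoch norm_q_lt_one (n - k))).mul
    (inv_qPoch norm_q_mul_lt_one n)).mul (inv_qPochInf norm_q_div_lt_one)).congr fun q z _ => ?_
  simp only [termI₂, pow_one, zpow_one, zpow_neg_one, zpow_zero, mul_one, ← div_eq_mul_inv]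
  rw [div_div, div_div, mul_comm (z ^ _), mul_assoc]

open IsMonomialSeries in
theorem isMonomialSeries_termII₁ (n : ℕ) : IsMonomialSeries fun q z => termII₁ k q z n := by
  refine ((((monomial (n + k.choose 2) (-k)).mul (inv_qPoch norm_q_lt_one (n - k))).mul
    (inv_qPoch norm_q_div_lt_one n)).mul (inv_qPochInf norm_q_mul_lt_one)).congr fun q z _ => ?_
  simp only [termII₁, pow_one, zpow_one, zpow_neg_one, zpow_zero, mul_one, ← div_eq_mul_inv]
  rw [div_div, div_div, mul_comm (z ^ _), mul_assoc]

open IsMonomialSeries in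
theorem isMonomialSeries_termII₂ (n : ℕ) : IsMonomialSeries fun q z => termII₂ k q z n := by
  refine ((((monomial (n - k + k.choose 2) k).mul (inv_qPoch norm_q_lt_one (n - k))).mul
    (inv_qPoch norm_q_mul_lt_one (n - 1))).mul
    (inv_qPochInf norm_q_div_lt_one)).congr fun q z _ => ?_
  simp only [termII₂, pow_one, zpow_one, zpow_neg_one, zpow_zero, mul_one, ← div_eq_mul_inv,
    zpow_natCast]
  rw [div_div, div_div, mul_comm (z ^ _), mul_assoc]

/-- The factor `(1 - z^m) / (1 - z)` is the polynomial `1 + z + ⋯ + z^{m-1}` away from `z = 1`. -/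
theorem hasNonnegExpansion_geom_mul (m : ℕ) {F : ℂ → ℂ → ℂ} (hF : IsMonomialSeries F) :
    HasNonnegExpansion fun q z => (1 - z ^ m) / (1 - z) * F q z := by
  refine ((IsMonomialSeries.sum (F := fun j q z => q ^ 0 * z ^ (j : ℤ))
    (fun j => .monomial 0 j) m).mul hF).hasNonnegExpansion fun q z _ hz => ?_
  simp only [pow_zero, one_mul, zpow_natCast]
  rw [geom_sum_eq hz, ← neg_div_neg_eq, neg_sub, neg_sub]

end Expansions

theorem theorem1p2 (k : ℕ) (hk : 1 ≤ k) :
    -- first identity: `z` avoids the zeros of `(z, q/z, q; q)_∞`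
    (∀ q z : ℂ, 0 < ‖q‖ → ‖q‖ < 1 → z ≠ 0 → (∀ m : ℤ, z ≠ q ^ m) →
      Summable (fun n : Set.Ici k => termI₁ k q z n) ∧
      Summable (fun n : Set.Ici k => termI₂ k q z n) ∧
      (-1) ^ (k - 1) / (qPochInf z q * qPochInf (q / z) q * qPochInf q q) *
            (∑ n ∈ Finset.range k,
              (-1) ^ n * q ^ (n * (n + 1) / 2) * z ^ (-(n : ℤ)) * (1 - z ^ (2 * n + 1))) -
          (-1) ^ (k - 1) =
        (∑' n : Set.Ici k, termI₁ k q z n) +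
          (1 - z ^ (2 * k - 1)) / (1 - z) * ∑' n : Set.Ici k, termI₂ k q z n) ∧
    -- second identity: `z` avoids the zeros of `(qz, q/z, q; q)_∞`
    (∀ q z : ℂ, 0 < ‖q‖ → ‖q‖ < 1 → z ≠ 0 → (∀ m : ℤ, m ≠ 0 → z ≠ q ^ m) →
      Summable (fun n : Set.Ici k => termII₁ k q z n) ∧
      Summable (fun n : Set.Ici k => termII₂ k q z n) ∧
      (-1) ^ (k - 1) / (qPochInf (q * z) q * qPochInf (q / z) q * qPochInf q q) *
            (∑ n ∈ Finset.Ioo (-(k : ℤ)) (k : ℤ),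
              (-1) ^ n * q ^ (n * (n - 1) / 2) * z ^ n) -
          (-1) ^ (k - 1) * (1 - z) =
        (∑' n : Set.Ici k, termII₁ k q z n) + ∑' n : Set.Ici k, termII₂ k q z n) ∧
    -- each series on the right-hand sides has non-negative coefficients in `q, z`
    HasNonnegExpansion (fun q z => ∑' n : Set.Ici k, termI₁ k q z n) ∧
    HasNonnegExpansion (fun q z =>
      (1 - z ^ (2 * k - 1)) / (1 - z) * ∑' n : Set.Ici k, termI₂ k q z n) ∧
    HasNonnegExpansion (fun q z => ∑' n : Set.Ici k, termII₁ k q z n) ∧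
    HasNonnegExpansion (fun q z => ∑' n : Set.Ici k, termII₂ k q z n) := by
  obtain ⟨k, rfl⟩ := Nat.exists_eq_add_of_le' hk
  refine ⟨fun q z hq0 hq hz0 hz => ?_, fun q z hq0 hq hz0 hz => ?_, ?_, ?_, ?_, ?_⟩
  · have hq0 := norm_pos_iff.1 hq0
    have hz' : ∀ m : ℤ, m ≠ 0 → z ≠ q ^ m := fun m _ => hz m
    exact ⟨(hasSum_termI₁ hq0 hq hz0 hz' hk).summable,
      (hasSum_termI₂ hq0 hq hz0 hz' _).summable, truncated_identity_one hq0 hq hz0 hz k⟩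
  · have hq0 := norm_pos_iff.1 hq0
    exact ⟨(hasSum_termII₁ hq0 hq hz0 hz _).summable,
      (hasSum_termII₂ hq0 hq hz k).summable, truncated_identity_two hq0 hq hz0 hz k⟩
  · refine (IsMonomialSeries.hasSum (κ := Set.Ici (k + 1))
      (fun n => isMonomialSeries_termI₁ (k + 1) n) fun q z hd => ?_).hasNonnegExpansion
      fun _ _ _ _ => rfl
    exact (hasSum_termI₁ hd.q_ne_zero hd.2.1 hd.z_ne_zero hd.ne_zpow hk).summable.hasSum
  · refine hasNonnegExpansion_geom_mul (2 * (k + 1) - 1) (IsMonomialSeries.hasSum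
      (κ := Set.Ici (k + 1)) (fun n => isMonomialSeries_termI₂ (k + 1) n) fun q z hd => ?_)
    exact (hasSum_termI₂ hd.q_ne_zero hd.2.1 hd.z_ne_zero hd.ne_zpow _).summable.hasSum
  · refine (IsMonomialSeries.hasSum (κ := Set.Ici (k + 1))
      (fun n => isMonomialSeries_termII₁ (k + 1) n) fun q z hd => ?_).hasNonnegExpansion
      fun _ _ _ _ => rfl
    exact (hasSum_termII₁ hd.q_ne_zero hd.2.1 hd.z_ne_zero hd.ne_zpow _).summable.hasSum
  · refine (IsMonomialSeries.hasSum (κ := Set.Ici (k + 1))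
      (fun n => isMonomialSeries_termII₂ (k + 1) n) fun q z hd => ?_).hasNonnegExpansion
      fun _ _ _ _ => rfl
    exact (hasSum_termII₂ hd.q_ne_zero hd.2.1 hd.ne_zpow _).summable.hasSum
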